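/- Let $X\subseteq\mathbb{R}^n$ be a closed convex set with non-empty interior, bounded or unbounded (for instance $X=\mathbb{R}^n$). A point $x\in X$ solves $VI(F,X)$ if $F(x)^T(y-x)\ge 0$ for all $y\in X$. Let $F:X\to\mathbb{R}^n$ be strongly pseudomonotone on $X$: there are constants $M>0$, $\alpha>0$ such that for all $x,y\in X$, $F(x)^T(y-x)\ge 0$ implies $F(y)^T(y-x)\ge M\|y-x\|^{\alpha}$. Let $C_j=\{x: A_jx\le b_j\}$ $(j=1,2,\dots)$ be polytopes, each with a point satisfying all the inequalities strictly, such that $C_j\subseteq C_{j+1}$ and $\overline{\bigcup_j C_j}=X$. If $\alpha=1$, assume in addition that $VI(F,X)$ has a solution that lies in some $C_j$. For $S\subseteq X$ put $g_S(x)=\sup_{y\in S}F(x)^T(x-y)\in(-\infty,+\infty]$ when $S\neq\emptyset$. Fix $0\le\eta<1$; an approximate analytic center of $\{x:Ax\le b\}$ is a point $x$ with $s=b-Ax\ge 0$ for which there is a vector $z$ with $A^Tz=0$ and $\|Zs-e\|\le\eta$, where $Z=\mathrm{diag}(z)$, $e=(1,\dots,1)^T$ and the norm is Euclidean. Consider the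 following algorithm (Algorithm 5). Start with $j=1$ and the system $(A,b)=(A_1,b_1)$. Repeat: choose an approximate analytic center $x$ of $\{y:Ay\le b\}$ as the next iterate. If $g_X(x)=0$, stop. Otherwise, if $g_{C_j}(x)<1/2^j$, increase $j$ by one and reset $(A,b)$ to $(A_j,b_j)$ for the new $j$; if $g_{C_j}(x)\ge 1/2^j$, append the cut $F(x)^Ty\le F(x)^Tx$ as a new row to $(A,b)$. Then the required approximate analytic centers always exist, and every run of the algorithm either stops after finitely many iterations at a solution of $VI(F,X)$, or produces an infinite sequence of iterates that has a subsequence converging to a point $x^*\in X$. -/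

import Mathlib

open scoped Matrix

noncomputable section

namespace ACCP

/-- A convex body that may be unbounded: a closed convex set with non-empty interior. -/
structure IsConvexBody {n : ℕ} (X : Set (EuclideanSpace ℝ (Fin n))) : Prop where
  convex : Convex ℝ X
  closed : IsClosed X
  interior_nonempty : (interior X).Nonempty

/-- A polytope is the convex hull of a finite set. -/
def IsPolytope {n : ℕ} (P : Set (EuclideanSpace ℝ (Fin n))) : Prop :=
  ∃ V : Set (EuclideanSpace ℝ (Fin n)), V.Finite ∧ P = convexHull ℝ V

/-- `x` is a solution of the variational inequality `VI(F, X)`. -/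
def IsVISolution {n : ℕ} (F : EuclideanSpace ℝ (Fin n) → EuclideanSpace ℝ (Fin n))
    (X : Set (EuclideanSpace ℝ (Fin n))) (x : EuclideanSpace ℝ (Fin n)) : Prop :=
  x ∈ X ∧ ∀ y ∈ X, 0 ≤ inner ℝ (F x) (y - x)

/-- Strong pseudomonotonicity on `X` with modulus `M` and exponent `α`. -/
def StronglyPseudomonotoneOn {n : ℕ}
    (F : EuclideanSpace ℝ (Fin n) → EuclideanSpace ℝ (Fin n))
    (X : Set (EuclideanSpace ℝ (Fin n))) (M α : ℝ) : Prop :=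
  ∀ x ∈ X, ∀ y ∈ X, 0 ≤ inner ℝ (F x) (y - x) → M * ‖y - x‖ ^ α ≤ inner ℝ (F y) (y - x)

/-- The gap function `g_S(x) = sup_{y ∈ S} F(x)ᵀ(x - y)`, with value `+∞` where the supremum is
infinite (which can happen only if `S` is unbounded). -/
def gap {n : ℕ} (F : EuclideanSpace ℝ (Fin n) → EuclideanSpace ℝ (Fin n))
    (S : Set (EuclideanSpace ℝ (Fin n))) (x : EuclideanSpace ℝ (Fin n)) : EReal :=
  ⨆ y ∈ S, ((inner ℝ (F x) (x - y) : ℝ) : EReal)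

/-- A finite system `A x ≤ b` of linear inequalities in `n` unknowns. -/
structure IneqSystem (n : ℕ) where
  /-- the number of inequalities -/
  m : ℕ
  /-- the coefficient matrix -/
  A : Matrix (Fin m) (Fin n) ℝ
  /-- the right-hand side -/
  b : Fin m → ℝ

namespace IneqSystem

/-- The vector of slacks `s = b - A x`. -/
def slack {n : ℕ} (S : IneqSystem n) (x : EuclideanSpace ℝ (Fin n)) : Fin S.m → ℝ :=
  fun i => S.b i - (S.A *ᵥ x.ofLp) i

/-- The polyhedron `{x | A x ≤ b}`. -/
def polyhedron {n : ℕ} (S : IneqSystem n) : Set (EuclideanSpace ℝ (Fin n)) :=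
  {x | ∀ i, 0 ≤ S.slack x i}

/-- Some point satisfies all the inequalities strictly. -/
def StrictlyFeasible {n : ℕ} (S : IneqSystem n) : Prop :=
  ∃ x, ∀ i, 0 < S.slack x i

/-- The system with the inequality `cᵀ x ≤ β` appended as a last row. -/
def addRow {n : ℕ} (S : IneqSystem n) (c : EuclideanSpace ℝ (Fin n)) (β : ℝ) : IneqSystem n where
  m := S.m + 1
  A := Matrix.of (Fin.snoc (α := fun _ => Fin n → ℝ) S.A c.ofLp)
  b := Fin.snoc (α := fun _ => ℝ) S.b β

/-- `x` is an approximate analytic center of `{x | A x ≤ b}` with precision `η`: with the slacks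
`s = b - A x ≥ 0` there is a dual vector `z` such that `Aᵀ z = 0` and `‖Z s - e‖ ≤ η` in the
Euclidean norm, `Z` being the diagonal matrix of `z` and `e` the vector of ones. -/
def IsApproxCenter {n : ℕ} (η : ℝ) (S : IneqSystem n) (x : EuclideanSpace ℝ (Fin n)) : Prop :=
  (∀ i, 0 ≤ S.slack x i) ∧
    ∃ z : Fin S.m → ℝ, S.Aᵀ *ᵥ z = 0 ∧
      ‖WithLp.toLp 2 (Matrix.diagonal z *ᵥ S.slack x - 1)‖ ≤ η

end IneqSystem

/-- A state of the algorithm: the stage and the current system of inequalities. The stages are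
numbered from `0`; stage `j` works on the polytope `C j` with tolerance `1 / 2 ^ (j + 1)`. -/
structure State (n : ℕ) where
  /-- the stage -/
  j : ℕ
  /-- the inequalities of the stage's polytope followed by the cuts made in this stage -/
  sys : IneqSystem n

/-- The initial state of stage `j`. -/
def State.start {n : ℕ} (C : ℕ → IneqSystem n) (j : ℕ) : State n := ⟨j, C j⟩

open Classical in
/-- The state that follows the iterate `x`: if the gap of `x` over the polytope of the stage is
below the tolerance, the next stage begins (without the cuts made so far); otherwise the cut
`F(x)ᵀ y ≤ F(x)ᵀ x` is appended. -/
def State.next {n : ℕ} (F : EuclideanSpace ℝ (Fin n) → EuclideanSpace ℝ (Fin n))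
    (C : ℕ → IneqSystem n) (σ : State n) (x : EuclideanSpace ℝ (Fin n)) : State n :=
  if gap F (C σ.j).polyhedron x < ((1 / 2 ^ (σ.j + 1) : ℝ) : EReal) then
    State.start C (σ.j + 1)
  else
    ⟨σ.j, σ.sys.addRow (F x) (inner ℝ (F x) x)⟩

/-- The states that the algorithm can reach without having stopped: in each state any approximate
analytic center may be taken as the iterate, and the algorithm stops at an iterate `x` with
`g_X(x) = 0`. -/
inductive Reachable {n : ℕ} (F : EuclideanSpace ℝ (Fin n) → EuclideanSpace ℝ (Fin n))
    (X : Set (EuclideanSpace ℝ (Fin n))) (C : ℕ → IneqSystem n) (η : ℝ) : State n → Prop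
  | init : Reachable F X C η (State.start C 0)
  | step (σ : State n) (x : EuclideanSpace ℝ (Fin n)) : Reachable F X C η σ →
      IneqSystem.IsApproxCenter η σ.sys x → gap F X x ≠ 0 →
      Reachable F X C η (State.next F C σ x)

/-- `σ` and `x` are the states and the iterates of a run of the algorithm. The run stops at the
first time `t` with `g_X(x t) = 0`, if there is one; later entries carry no meaning and are not
constrained. -/
structure IsRun {n : ℕ} (F : EuclideanSpace ℝ (Fin n) → EuclideanSpace ℝ (Fin n))
    (X : Set (EuclideanSpace ℝ (Fin n))) (C : ℕ → IneqSystem n) (η : ℝ)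
    (σ : ℕ → State n) (x : ℕ → EuclideanSpace ℝ (Fin n)) : Prop where
  init : σ 0 = State.start C 0
  center : ∀ t, (∀ s < t, gap F X (x s) ≠ 0) → IneqSystem.IsApproxCenter η (σ t).sys (x t)
  next : ∀ t, (∀ s ≤ t, gap F X (x s) ≠ 0) → σ (t + 1) = State.next F C (σ t) (x t)

end ACCP

end

/-! A center exists because every reachable system is strictly feasible with compact polyhedron,
where the product of the slacks has a positive maximum. Approximate centers have positive slacks, so
a cut through one keeps strict feasibility.

For an infinite run it suffices that infinitely many iterates lie in one bounded set. If the stages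
are bounded, all iterates lie in one polytope. Otherwise infinitely many iterates end a stage, and
there the gap bound gives `F(x)ᵀ(x - p) ≤ 1` for a fixed `p`; strong pseudomonotonicity turns this
into a bound on `‖x - p‖` (`exists_stage_ball_of_gap_lt`). Continuity of `F` plays no role. -/

namespace ACCP

/-! ### Inequality systems and analytic centers -/

namespace IneqSystem

variable {n : ℕ}

theorem slack_add_smul (S : IneqSystem n) (x v : EuclideanSpace ℝ (Fin n)) (t : ℝ) (i : Fin S.m) :
    S.slack (x + t • v) i = S.slack x i - t * (S.A *ᵥ v.ofLp) i := by
  simp only [slack, WithLp.ofLp_add, WithLp.ofLp_smul, Matrix.mulVec_add, Matrix.mulVec_smul,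
    Pi.add_apply, Pi.smul_apply, smul_eq_mul]
  ring

theorem continuous_slack (S : IneqSystem n) (i : Fin S.m) : Continuous fun x => S.slack x i := by
  unfold slack Matrix.mulVec dotProduct
  fun_prop

theorem isClosed_polyhedron (S : IneqSystem n) : IsClosed S.polyhedron := by
  simp only [polyhedron, Set.ofPred_forall]
  exact isClosed_iInter fun i => isClosed_le continuous_const (S.continuous_slack i)

theorem eventually_slack_pos (S : IneqSystem n) {x : EuclideanSpace ℝ (Fin n)}
    (hx : ∀ i, 0 < S.slack x i) (v : EuclideanSpace ℝ (Fin n)) :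
    ∀ᶠ t : ℝ in nhds 0, ∀ i, 0 < S.slack (x + t • v) i := by
  refine Filter.eventually_all.2 fun i => ?_
  have hc : Continuous fun t : ℝ => S.slack (x + t • v) i :=
    (S.continuous_slack i).comp (by fun_prop)
  refine hc.continuousAt.eventually (lt_mem_nhds ?_)
  simpa using hx i

/-- Approximate analytic centers lie in the interior. -/
theorem IsApproxCenter.slack_pos {S : IneqSystem n} {η : ℝ} (hη : η < 1)
    {x : EuclideanSpace ℝ (Fin n)} (h : S.IsApproxCenter η x) (i : Fin S.m) :
    0 < S.slack x i := by
  obtain ⟨hs, z, -, hz⟩ := h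
  refine lt_of_le_of_ne (hs i) fun h0 => ?_
  -- A zero slack makes this coordinate of `Zs - e` equal to `-1`, so the norm would be at least `1
  -- > η`.
  have h1 := (PiLp.norm_apply_le (WithLp.toLp 2 (Matrix.diagonal z *ᵥ S.slack x - 1)) i).trans hz
  simp only [Pi.sub_apply, Matrix.mulVec_diagonal, ← h0] at h1
  norm_num at h1
  linarith

/-- A maximiser of the product of the slacks is the analytic center. -/
theorem exists_isApproxCenter (S : IneqSystem n) {η : ℝ} (hη : 0 ≤ η)
    (hS : S.StrictlyFeasible) (hc : IsCompact S.polyhedron) :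
    ∃ x, S.IsApproxCenter η x := by
  obtain ⟨x₀, hx₀⟩ := hS
  obtain ⟨x, hx, hmax⟩ := hc.exists_isMaxOn ⟨x₀, fun i => (hx₀ i).le⟩
    (f := fun x => ∏ i, S.slack x i)
    (continuous_finsetProd _ fun i _ => S.continuous_slack i).continuousOn
  have hprod : 0 < ∏ i, S.slack x i :=
    (Finset.prod_pos fun i _ => hx₀ i).trans_le (hmax fun i => (hx₀ i).le)
  have hpos : ∀ i, 0 < S.slack x i := fun i =>
    lt_of_le_of_ne (hx i) fun h =>
      hprod.ne' (Finset.prod_eq_zero (Finset.mem_univ i) h.symm)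
  -- With `z = 1/s` one has `Zs = e` exactly, and `Aᵀz = 0` is stationarity of the log of the
  -- product along each coordinate direction.
  refine ⟨x, hx, fun i => (S.slack x i)⁻¹, ?_, ?_⟩
  · funext k
    set v : EuclideanSpace ℝ (Fin n) := EuclideanSpace.single k 1 with hv
    have hAv : ∀ i, (S.A *ᵥ v.ofLp) i = S.A i k := fun i => by
      simp [hv]
    have hd : HasDerivAt (fun t : ℝ => ∑ i, Real.log (S.slack x i - t * S.A i k))
        (∑ i, (-S.A i k) / S.slack x i) 0 := by
      refine HasDerivAt.fun_sum fun i _ => ?_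
      have h1 : HasDerivAt (fun t : ℝ => S.slack x i - t * S.A i k) (-S.A i k) 0 := by
        simpa using ((hasDerivAt_id (0 : ℝ)).mul_const (S.A i k)).const_sub (S.slack x i)
      simpa using h1.log (by simpa using (hpos i).ne')
    have hloc : IsLocalMax (fun t : ℝ => ∑ i, Real.log (S.slack x i - t * S.A i k)) 0 := by
      filter_upwards [S.eventually_slack_pos hpos v] with t ht
      have hle : ∏ i, S.slack (x + t • v) i ≤ ∏ i, S.slack x i := hmax fun i => (ht i).le
      simp only [slack_add_smul, hAv] at ht hle
      simp only [zero_mul, sub_zero]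
      rw [← Real.log_prod fun i _ => (ht i).ne', ← Real.log_prod fun i _ => (hpos i).ne']
      exact Real.log_le_log (Finset.prod_pos fun i _ => ht i) hle
    have h0 := hloc.hasDerivAt_eq_zero hd
    simp only [neg_div, Finset.sum_neg_distrib, neg_eq_zero] at h0
    simpa [Matrix.mulVec, dotProduct, div_eq_mul_inv] using h0
  · have : Matrix.diagonal (fun i => (S.slack x i)⁻¹) *ᵥ S.slack x - 1 = 0 := by
      funext i
      simp [Matrix.mulVec_diagonal, (hpos i).ne']
    rw [this]
    simpa using hη

theorem slack_addRow_castSucc (S : IneqSystem n) (c : EuclideanSpace ℝ (Fin n)) (β : ℝ)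
    (x : EuclideanSpace ℝ (Fin n)) (i : Fin S.m) :
    (S.addRow c β).slack x (Fin.castSucc i) = S.slack x i := by
  have hA : (S.addRow c β).A (Fin.castSucc i) = S.A i :=
    Fin.snoc_castSucc (α := fun _ => Fin n → ℝ) c.ofLp S.A i
  have hb : (S.addRow c β).b (Fin.castSucc i) = S.b i :=
    Fin.snoc_castSucc (α := fun _ => ℝ) β S.b i
  simp only [slack, Matrix.mulVec, hA, hb]

theorem slack_addRow_last (S : IneqSystem n) (c : EuclideanSpace ℝ (Fin n)) (β : ℝ)
    (x : EuclideanSpace ℝ (Fin n)) :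
    (S.addRow c β).slack x (Fin.last S.m) = β - inner ℝ c x := by
  have hA : (S.addRow c β).A (Fin.last S.m) = c.ofLp :=
    Fin.snoc_last (α := fun _ => Fin n → ℝ) c.ofLp S.A
  have hb : (S.addRow c β).b (Fin.last S.m) = β := Fin.snoc_last (α := fun _ => ℝ) β S.b
  simp only [slack, Matrix.mulVec, hA, hb]
  simp [dotProduct, PiLp.inner_apply, mul_comm]

theorem polyhedron_addRow_subset (S : IneqSystem n) (c : EuclideanSpace ℝ (Fin n)) (β : ℝ) :
    (S.addRow c β).polyhedron ⊆ S.polyhedron := fun x hx i => by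
  have := hx (Fin.castSucc i)
  rwa [slack_addRow_castSucc] at this

/-- A cut through a strictly feasible point leaves a strictly feasible system. -/
theorem strictlyFeasible_addRow (S : IneqSystem n) {c x : EuclideanSpace ℝ (Fin n)}
    (hc : c ≠ 0) (hx : ∀ i, 0 < S.slack x i) :
    (S.addRow c (inner ℝ c x)).StrictlyFeasible := by
  obtain ⟨t, ht, hlt⟩ := (((S.eventually_slack_pos hx c).filter_mono
    nhdsWithin_le_nhds).and (self_mem_nhdsWithin : Set.Iio (0 : ℝ) ∈ _)).exists
  refine ⟨x + t • c, fun i => ?_⟩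
  refine Fin.lastCases ?_ (fun i => ?_) i
  · rw [slack_addRow_last, inner_add_right, inner_smul_right, real_inner_self_eq_norm_sq]
    have := mul_neg_of_neg_of_pos (Set.mem_Iio.1 hlt) (pow_pos (norm_pos_iff.2 hc) 2)
    linarith
  · rw [slack_addRow_castSucc]
    exact ht i

end IneqSystem

/-! ### Invariants of the algorithm -/

variable {n : ℕ} {F : EuclideanSpace ℝ (Fin n) → EuclideanSpace ℝ (Fin n)}
  {X : Set (EuclideanSpace ℝ (Fin n))} {C : ℕ → IneqSystem n}

theorem IsPolytope.isCompact {P : Set (EuclideanSpace ℝ (Fin n))} (hP : IsPolytope P) :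
    IsCompact P := by
  obtain ⟨V, hV, rfl⟩ := hP
  exact hV.isCompact_convexHull ℝ

theorem inner_le_of_gap_le {S : Set (EuclideanSpace ℝ (Fin n))} {x y : EuclideanSpace ℝ (Fin n)}
    {r : ℝ} (h : gap F S x ≤ r) (hy : y ∈ S) : inner ℝ (F x) (x - y) ≤ r :=
  EReal.coe_le_coe_iff.1 ((le_iSup₂ (f := fun y _ => ((inner ℝ (F x) (x - y) : ℝ) : EReal))
    y hy).trans h)

theorem isVISolution_of_gap_eq_zero {x : EuclideanSpace ℝ (Fin n)} (hx : x ∈ X)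
    (h : gap F X x = 0) : IsVISolution F X x := by
  refine ⟨hx, fun y hy => ?_⟩
  have h1 := inner_le_of_gap_le (F := F) (x := x) (r := 0) (by simp [h]) hy
  rw [← neg_sub, inner_neg_right] at h1
  linarith

theorem gap_le_zero_of_eq_zero {S : Set (EuclideanSpace ℝ (Fin n))}
    {x : EuclideanSpace ℝ (Fin n)} (h : F x = 0) : gap F S x ≤ 0 := by
  refine iSup₂_le fun y _ => ?_
  simp [h]

theorem Reachable.polyhedron_subset_and_strictlyFeasible {η : ℝ} (hη : η < 1)
    (hC : ∀ j, (C j).StrictlyFeasible) {σ : State n} (h : Reachable F X C η σ) :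
    σ.sys.polyhedron ⊆ (C σ.j).polyhedron ∧ σ.sys.StrictlyFeasible := by
  induction h with
  | init => exact ⟨subset_rfl, hC 0⟩
  | step σ x _ hx _ ih =>
    unfold State.next
    split_ifs with hg
    · exact ⟨subset_rfl, hC _⟩
    · refine ⟨(σ.sys.polyhedron_addRow_subset _ _).trans ih.1,
        -- A cut is never degenerate: `F x = 0` would put the gap below the positive tolerance and
        -- end the stage.
        σ.sys.strictlyFeasible_addRow (fun h0 => hg ?_) (hx.slack_pos hη)⟩
      refine (gap_le_zero_of_eq_zero h0).trans_lt ?_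
      exact EReal.coe_pos.2 (by positivity)

theorem IsRun.reachable {η : ℝ} {σ : ℕ → State n} {x : ℕ → EuclideanSpace ℝ (Fin n)}
    (h : IsRun F X C η σ x) (t : ℕ) (ht : ∀ s < t, gap F X (x s) ≠ 0) :
    Reachable F X C η (σ t) := by
  induction t with
  | zero => rw [h.init]; exact .init
  | succ t ih =>
    have ht' : ∀ s < t, gap F X (x s) ≠ 0 := fun s hs => ht s (by omega)
    rw [h.next t fun s hs => ht s (by omega)]
    exact .step _ _ (ih ht') (h.center t ht') (ht t (by omega))

theorem IsRun.mem_polyhedron {η : ℝ} (hη : η < 1) (hC : ∀ j, (C j).StrictlyFeasible)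
    {σ : ℕ → State n} {x : ℕ → EuclideanSpace ℝ (Fin n)}
    (h : IsRun F X C η σ x) (t : ℕ) (ht : ∀ s < t, gap F X (x s) ≠ 0) :
    x t ∈ (C (σ t).j).polyhedron :=
  ((h.reachable t ht).polyhedron_subset_and_strictlyFeasible hη hC).1 (h.center t ht).1

theorem State.next_j_cases (σ : State n) (x : EuclideanSpace ℝ (Fin n)) :
    (State.next F C σ x).j = σ.j ∨ ((State.next F C σ x).j = σ.j + 1 ∧
      gap F (C σ.j).polyhedron x < ((1 / 2 ^ (σ.j + 1) : ℝ) : EReal)) := by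
  unfold State.next
  split_ifs with hg
  · exact .inr ⟨rfl, hg⟩
  · exact .inl rfl

/-- If a natural-number sequence that starts at `0` and moves by steps of `0` or `1` is unbounded,
it moves at arbitrarily late times from arbitrarily late positions. -/
theorem frequently_step_of_unbounded {a : ℕ → ℕ} (h0 : a 0 = 0)
    (hstep : ∀ t, a (t + 1) = a t ∨ a (t + 1) = a t + 1) (hub : ∀ J, ∃ t, J < a t) (J : ℕ) :
    ∃ᶠ t in Filter.atTop, J ≤ a t ∧ a (t + 1) = a t + 1 := by
  have hmono : Monotone a := monotone_nat_of_le_succ fun t => by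
    rcases hstep t with h | h <;> omega
  refine Filter.frequently_atTop.2 fun N => ?_
  -- The first time the sequence exceeds `max J (a N)` comes after `N`, and the step into it starts
  -- from a value of at least `J`.
  classical
  have hex := hub (max J (a N))
  have hlt := Nat.find_spec hex
  obtain ⟨s, hs⟩ : ∃ s, Nat.find hex = s + 1 :=
    Nat.exists_eq_succ_of_ne_zero fun h => by rw [h, h0] at hlt; omega
  have hle : ¬ max J (a N) < a s := Nat.find_min hex (by omega)
  rw [hs] at hlt
  refine ⟨s, ?_, ?_, ?_⟩
  · by_contra hsN
    have := hmono (show s + 1 ≤ N by omega)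
    omega
  all_goals rcases hstep s with h | h <;> omega

/-! ### Boundedness from strong pseudomonotonicity -/

/-- Strong pseudomonotonicity with an exponent below one is possible on a one-point set only. -/
theorem StronglyPseudomonotoneOn.subsingleton_of_lt_one {M α : ℝ} (hX : Convex ℝ X) (hM : 0 < M)
    (hα : α < 1) (hF : StronglyPseudomonotoneOn F X M α) : X.Subsingleton := by
  have key : ∀ u ∈ X, ∀ v ∈ X, 0 ≤ inner ℝ (F u) (v - u) → u = v := by
    intro u hu v hv h
    by_contra hne
    have hpos : 0 < ‖v - u‖ := norm_pos_iff.2 (sub_ne_zero.2 (Ne.symm hne))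
    -- Pass from `u` to `v` through a point `w` near `v`. Divided by `t`, the bound has left side of
    -- order `t ^ (α - 1)`, which blows up as `t → 0`.
    have hbound : ∀ t ∈ Set.Ioo (0 : ℝ) 1,
        M * (t * ‖v - u‖) ^ α ≤ t * inner ℝ (F v) (v - u) := by
      intro t ht
      set w := v - t • (v - u) with hw
      have hwX : w ∈ X := by
        have := hX hu hv ht.1.le (sub_nonneg.2 ht.2.le) (by ring)
        convert this using 1
        rw [hw]; module
      have hwu : w - u = (1 - t) • (v - u) := by rw [hw]; module
      have hvw : v - w = t • (v - u) := by rw [hw]; module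
      have h1 := hF u hu w hwX (by
        rw [hwu, inner_smul_right]
        exact mul_nonneg (sub_nonneg.2 ht.2.le) h)
      rw [hwu, inner_smul_right] at h1
      have h2 : 0 ≤ inner ℝ (F w) (v - u) :=
        nonneg_of_mul_nonneg_right (le_trans (by positivity) h1) (sub_pos.2 ht.2)
      have h3 := hF w hwX v hv (by
        rw [hvw, inner_smul_right]
        exact mul_nonneg ht.1.le h2)
      rwa [hvw, inner_smul_right, norm_smul, Real.norm_of_nonneg ht.1.le] at h3
    have htend : Filter.Tendsto (fun t : ℝ => M * ‖v - u‖ ^ α * t ^ (α - 1))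
        (nhdsWithin 0 (Set.Ioi 0)) Filter.atTop :=
      (tendsto_rpow_neg_nhdsGT_zero (by linarith)).const_mul_atTop (by positivity)
    obtain ⟨t, ht1, ht2⟩ := ((htend.eventually_gt_atTop (inner ℝ (F v) (v - u))).and
      (Ioo_mem_nhdsGT (zero_lt_one (α := ℝ)))).exists
    have h1 := hbound t ht2
    rw [Real.mul_rpow ht2.1.le hpos.le] at h1
    have h2 : t ^ α = t ^ (α - 1) * t := by
      rw [← Real.rpow_add_one ht2.1.ne']; ring_nf
    rw [h2] at h1
    have h3 := mul_lt_mul_of_pos_left ht1 ht2.1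
    linarith
  intro u hu v hv
  -- From the midpoint, the directions to `u` and `v` are opposite, so `key` applies to one of them.
  have hmX : midpoint ℝ u v ∈ X := hX.midpoint_mem hu hv
  have hneg : v - midpoint ℝ u v = -(u - midpoint ℝ u v) := by
    rw [right_sub_midpoint, left_sub_midpoint, ← smul_neg, neg_sub]
  rcases le_total 0 (inner ℝ (F (midpoint ℝ u v)) (u - midpoint ℝ u v)) with h | h
  · exact ((midpoint_eq_left_iff ℝ).1 (key _ hmX _ hu h))
  · refine ((midpoint_eq_right_iff ℝ).1 (key _ hmX _ hv ?_))
    rw [hneg, inner_neg_right]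
    linarith

/-- For an exponent above one, the points at which the merit `F(x)ᵀ(x - p)` is at most `1` form a
bounded set, for every `p ∈ X`. -/
theorem StronglyPseudomonotoneOn.exists_norm_sub_le_of_one_lt {M α : ℝ} (hX : Convex ℝ X)
    (hM : 0 < M) (hα : 1 < α) (hF : StronglyPseudomonotoneOn F X M α)
    {p : EuclideanSpace ℝ (Fin n)} (hp : p ∈ X) :
    ∃ R, ∀ x ∈ X, inner ℝ (F x) (x - p) ≤ 1 → ‖x - p‖ ≤ R := by
  have ht1 : Filter.Tendsto (fun r : ℝ => M * r ^ α) Filter.atTop Filter.atTop :=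
    (tendsto_rpow_atTop (by linarith)).const_mul_atTop hM
  have ht2 : Filter.Tendsto (fun r : ℝ => M * r ^ (α - 1)) Filter.atTop Filter.atTop :=
    (tendsto_rpow_atTop (by linarith)).const_mul_atTop hM
  obtain ⟨R, hR⟩ := Filter.eventually_atTop.1 ((ht1.eventually_gt_atTop 1).and
    ((ht2.eventually_gt_atTop ‖F p‖).and (Filter.eventually_gt_atTop 0)))
  refine ⟨2 * R, fun x hx hle => ?_⟩
  by_contra! hlt
  obtain ⟨hr1, hr2, hr0⟩ := hR (‖x - p‖ / 2) (by linarith)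
  set m := midpoint ℝ p x with hm
  have hmX : m ∈ X := hX.midpoint_mem hp hx
  have hxm : x - m = (1 / 2 : ℝ) • (x - p) := by
    rw [hm, right_sub_midpoint]; norm_num
  have hpm : p - m = -((1 / 2 : ℝ) • (x - p)) := by
    rw [hm, left_sub_midpoint, ← smul_neg, neg_sub]; norm_num
  have hn : ‖(1 / 2 : ℝ) • (x - p)‖ = ‖x - p‖ / 2 := by
    rw [norm_smul]; norm_num; ring
  -- With `r = ‖x - p‖ / 2`, the first case contradicts the merit bound through `M r ^ α > 1`, the
  -- second contradicts Cauchy–Schwarz at `p` through `M r ^ (α - 1) > ‖F p‖`.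
  rcases le_total 0 (inner ℝ (F m) (x - m)) with h | h
  · have h1 := hF m hmX x hx h
    rw [hxm, hn, inner_smul_right] at h1
    linarith
  · have h1 := hF m hmX p hp (by rw [hpm, ← hxm, inner_neg_right]; linarith)
    have h2 := real_inner_le_norm (F p) (p - m)
    rw [hpm, norm_neg, hn] at h1 h2
    have h3 : (‖x - p‖ / 2) ^ α = (‖x - p‖ / 2) ^ (α - 1) * (‖x - p‖ / 2) := by
      rw [← Real.rpow_add_one hr0.ne']; ring_nf
    rw [h3] at h1
    have h4 := mul_lt_mul_of_pos_right hr2 hr0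
    linarith

/-- From some stage on, the iterates that end a stage stay in a fixed ball. -/
theorem exists_stage_ball_of_gap_lt (hX : Convex ℝ X) {M α : ℝ} (hM : 0 < M)
    (hF : StronglyPseudomonotoneOn F X M α)
    (hCX : ∀ j, (C j).polyhedron ⊆ X) (hmono : Monotone fun j => (C j).polyhedron)
    (hne : (C 0).polyhedron.Nonempty)
    (h_one : α = 1 → ∃ p, IsVISolution F X p ∧ ∃ j, p ∈ (C j).polyhedron) :
    ∃ (J : ℕ) (p : EuclideanSpace ℝ (Fin n)) (R : ℝ), ∀ j ≥ J, ∀ x ∈ X,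
      gap F (C j).polyhedron x < ((1 / 2 ^ (j + 1) : ℝ) : EReal) → ‖x - p‖ ≤ R := by
  have hgap : ∀ {j p x}, p ∈ (C j).polyhedron →
      gap F (C j).polyhedron x < ((1 / 2 ^ (j + 1) : ℝ) : EReal) →
      inner ℝ (F x) (x - p) ≤ 1 := fun {j p x} hp h =>
    (inner_le_of_gap_le h.le hp).trans
      ((div_le_one (by positivity)).2 (one_le_pow₀ one_le_two))
  rcases lt_trichotomy α 1 with hlt | heq | hgt
  · obtain ⟨p, hp⟩ := hne
    refine ⟨0, p, 0, fun j _ x hx _ => ?_⟩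
    rw [hF.subsingleton_of_lt_one hX hM hlt hx (hCX 0 hp)]
    simp
  · obtain ⟨p, hp, J, hpJ⟩ := h_one heq
    -- For a solution `p`, `M‖x - p‖ ≤ F(x)ᵀ(x - p)` holds directly; the gap controls the right side
    -- only once `p` is in the polytope of the stage.
    refine ⟨J, p, 1 / M, fun j hj x hx hg => ?_⟩
    have h1 := hF p hp.1 x hx (hp.2 x hx)
    rw [heq, Real.rpow_one] at h1
    rw [le_div_iff₀ hM, mul_comm]
    exact h1.trans (hgap (hmono hj hpJ) hg)
  · obtain ⟨p, hp⟩ := hne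
    obtain ⟨R, hR⟩ := hF.exists_norm_sub_le_of_one_lt hX hM hgt (hCX 0 hp)
    exact ⟨0, p, R, fun j _ x hx hg => hR x hx (hgap (hmono (Nat.zero_le j) hp) hg)⟩

end ACCP

/-! ### The main theorem -/

theorem theorem7 {n : ℕ} (X : Set (EuclideanSpace ℝ (Fin n))) (hX : ACCP.IsConvexBody X)
    (F : EuclideanSpace ℝ (Fin n) → EuclideanSpace ℝ (Fin n))
    (M α : ℝ) (hM : 0 < M) (hα : 0 < α)
    (hF : ACCP.StronglyPseudomonotoneOn F X M α)
    (C : ℕ → ACCP.IneqSystem n)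
    (hC_polytope : ∀ j, ACCP.IsPolytope (C j).polyhedron)
    (hC_feasible : ∀ j, (C j).StrictlyFeasible)
    (hC_mono : ∀ j, (C j).polyhedron ⊆ (C (j + 1)).polyhedron)
    (hC_closure : closure (⋃ j, (C j).polyhedron) = X)
    (h_one : α = 1 → ∃ p, ACCP.IsVISolution F X p ∧ ∃ j, p ∈ (C j).polyhedron)
    (η : ℝ) (hη0 : 0 ≤ η) (hη1 : η < 1) :
    (∀ σ, ACCP.Reachable F X C η σ → ∃ x, ACCP.IneqSystem.IsApproxCenter η σ.sys x) ∧
    ∀ (σ : ℕ → ACCP.State n) (x : ℕ → EuclideanSpace ℝ (Fin n)), ACCP.IsRun F X C η σ x →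
      (∃ T, (∀ t < T, ACCP.gap F X (x t) ≠ 0) ∧ ACCP.gap F X (x T) = 0 ∧
        ACCP.IsVISolution F X (x T)) ∨
      ((∀ t, ACCP.gap F X (x t) ≠ 0) ∧
        ∃ p ∈ X, ∃ φ : ℕ → ℕ, StrictMono φ ∧
          Filter.Tendsto (fun i => x (φ i)) Filter.atTop (nhds p)) := by
  have hCX : ∀ j, (C j).polyhedron ⊆ X := fun j =>
    hC_closure ▸ (Set.subset_iUnion (fun j => (C j).polyhedron) j).trans subset_closure
  have hmono : Monotone fun j => (C j).polyhedron := monotone_nat_of_le_succ hC_mono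
  have hne : (C 0).polyhedron.Nonempty := by
    obtain ⟨y, hy⟩ := hC_feasible 0
    exact ⟨y, fun i => (hy i).le⟩
  refine ⟨fun σ hσ => ?_, fun σ x hrun => ?_⟩
  · obtain ⟨hsub, hfeas⟩ := hσ.polyhedron_subset_and_strictlyFeasible hη1 hC_feasible
    exact σ.sys.exists_isApproxCenter hη0 hfeas
      ((hC_polytope σ.j).isCompact.of_isClosed_subset σ.sys.isClosed_polyhedron hsub)
  by_cases hgap : ∃ T, ACCP.gap F X (x T) = 0
  · classical
    have hbefore : ∀ t < Nat.find hgap, ACCP.gap F X (x t) ≠ 0 := fun t ht =>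
      Nat.find_min hgap ht
    exact .inl ⟨Nat.find hgap, hbefore, Nat.find_spec hgap,
      ACCP.isVISolution_of_gap_eq_zero
        (hCX _ (hrun.mem_polyhedron hη1 hC_feasible _ hbefore)) (Nat.find_spec hgap)⟩
  push Not at hgap
  refine .inr ⟨hgap, ?_⟩
  have hmem : ∀ t, x t ∈ (C (σ t).j).polyhedron := fun t =>
    hrun.mem_polyhedron hη1 hC_feasible t fun s _ => hgap s
  have hxX : ∀ t, x t ∈ X := fun t => hCX _ (hmem t)
  have hnext : ∀ t, σ (t + 1) = ACCP.State.next F C (σ t) (x t) := fun t =>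
    hrun.next t fun s _ => hgap s
  suffices hfreq : ∃ B : Set (EuclideanSpace ℝ (Fin n)), Bornology.IsBounded B ∧
      ∃ᶠ t in Filter.atTop, x t ∈ B by
    obtain ⟨B, hB, hBx⟩ := hfreq
    obtain ⟨p, -, φ, hφ, hp⟩ := tendsto_subseq_of_frequently_bounded hB hBx
    exact ⟨p, hX.closed.mem_of_tendsto hp (.of_forall fun i => hxX _), φ, hφ, hp⟩
  by_cases hbdd : ∃ J, ∀ t, (σ t).j ≤ J
  · obtain ⟨J, hJ⟩ := hbdd
    exact ⟨_, (hC_polytope J).isCompact.isBounded,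
      Filter.Frequently.of_forall fun t => hmono (hJ t) (hmem t)⟩
  push Not at hbdd
  obtain ⟨J, p, R, hR⟩ :=
    ACCP.exists_stage_ball_of_gap_lt hX.convex hM hF hCX hmono hne h_one
  refine ⟨Metric.closedBall p R, Metric.isBounded_closedBall, ?_⟩
  refine (ACCP.frequently_step_of_unbounded (a := fun t => (σ t).j) (by rw [hrun.init]; rfl)
    (fun t => ?_) hbdd J).mono fun t ht => ?_
  · rw [hnext t]
    exact (ACCP.State.next_j_cases (σ t) (x t)).imp_right And.left
  · rw [hnext t] at ht
    rw [mem_closedBall_iff_norm]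
    rcases ACCP.State.next_j_cases (F := F) (C := C) (σ t) (x t) with h | h
    · omega
    · exact hR _ ht.1 _ (hxX t) h.2
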